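/- **Theorem.** Let $\mathbb{S}$ be the Sierpinski space, with carrier $2=\{0,1\}$ and open sets $\emptyset,\{1\},\{0,1\}$. Let $\mathbf{MSL}$ be the category of meet-semilattices with a top element and maps preserving finite meets and top. Read $2$ also as the meet-semilattice with $0\le 1$. For $M\in\mathbf{MSL}$, regard $\mathbf{MSL}(M,2)$ as a subspace of the power $\mathbb{S}^{|M|}$. For a topological space $X$, regard $\mathbf{Top}(X,\mathbb{S})$ as a meet-semilattice with pointwise operations. The functors $\mathbf{Top}(-,\mathbb{S})\colon \mathbf{Top}\to\mathbf{MSL}^{\mathrm{op}}$ and $\mathbf{MSL}(-,2)\colon \mathbf{MSL}^{\mathrm{op}}\to\mathbf{Top}$ form a dual adjunction $\mathbf{Top}(-,\mathbb{S})\dashv\mathbf{MSL}(-,2)$, with unit and counit given by evaluation. Let $\overline{\mathcal F}X=\mathbf{MSL}(\mathbf{Top}(X,\mathbb{S}),2)$ be the induced monad on $\mathbf{Top}$. 1. $\overline{\mathcal F}$ is isomorphic, as a monad, to the monad of filters of open sets. The latter sends a space $X$ to the set of all (possibly improper) filters $F$ of its lattice of open sets $\mathcal O(X)$, topologised inside $\mathbb{S}^{\mathcal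 O(X)}$. On a continuous map $f\colon X\to Y$ it is $F\mapsto\{V\in\mathcal O(Y) : f^{-1}V\in F\}$. Its unit sends a point to the filter of its open neighbourhoods. Its multiplication is $\mathfrak F\mapsto\{U\in\mathcal O(X) : \{F : U\in F\}\in\mathfrak F\}$. The isomorphism sends $\chi\in\overline{\mathcal F}X$ to the filter $\{U\in\mathcal O(X) : \chi(1_U)=1\}$, where $1_U$ is the characteristic map of $U$. 2. Let $\mathcal P_{\mathsf f}$ be the finite power set monad on $\mathbf{Set}$, let $\mathbf{Kl}_{\mathsf f}(\mathcal P_{\mathsf f})$ be the full subcategory of its Kleisli category given by the finite sets, and let $U_{\mathcal P_{\mathsf f}}\colon \mathbf{Kl}_{\mathsf f}(\mathcal P_{\mathsf f})\to\mathbf{Top}$ be the functor that sends a finite set $X$ to $\mathcal P_{\mathsf f}X\cong\mathbb{S}^X$ and a Kleisli morphism $f\colon X\to\mathcal P_{\mathsf f}Y$ to $A\mapsto\bigcup_{x\in A}f(x)$. Here $\mathcal P_{\mathsf f}X$, the free meet-semilattice with top on $X$ (with $\cup$ as meet and $\emptyset$ as top), is identified with the power $2^X$ of the meet-semilattice $2$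 by sending $A\subseteq X$ to the map $X\to 2$ that is $0$ exactly on $A$. Equivalently, $f$ is sent to the map $\mathbb{S}^X\to\mathbb{S}^Y$, $\varphi\mapsto\bigl(y\mapsto\bigwedge_{x:\,y\in f(x)}\varphi(x)\bigr)$. Then the right Kan extension of $U_{\mathcal P_{\mathsf f}}$ along itself exists and is pointwise, and the codensity monad of $U_{\mathcal P_{\mathsf f}}$ is isomorphic, as a monad, to $\overline{\mathcal F}$. -/

import Mathlib

open CategoryTheory Opposite TopologicalSpace

universe v₁ v₂ u₁ u₂ u

/-! ### Codensity monads -/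

section Codensity

variable {A : Type u₁} [Category.{v₁} A] {C : Type u₂} [Category.{v₂} C]

/-- The unit of the codensity monad of `F`: the transformation `𝟭 ⟶ Ran_F F` that corresponds
to the identity `F ⟶ F`. -/
noncomputable def codensityUnit (F : A ⥤ C) [F.HasRightKanExtension F] :
    𝟭 C ⟶ F.rightKanExtension F :=
  (F.rightKanExtension F).liftOfIsRightKanExtension (F.rightKanExtensionCounit F) (𝟭 C)
    F.rightUnitor.hom

/-- The multiplication of the codensity monad of `F`: with `T = Ran_F F` and counit `φ`, the
transformation `T T ⟶ T` that corresponds to `T T F ⟶ T F ⟶ F`, given by `T φ` and `φ`. -/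
noncomputable def codensityMult (F : A ⥤ C) [F.HasRightKanExtension F] :
    F.rightKanExtension F ⋙ F.rightKanExtension F ⟶ F.rightKanExtension F :=
  (F.rightKanExtension F).liftOfIsRightKanExtension (F.rightKanExtensionCounit F)
    (F.rightKanExtension F ⋙ F.rightKanExtension F)
    ((Functor.associator F (F.rightKanExtension F) (F.rightKanExtension F)).inv ≫
      Functor.whiskerRight (F.rightKanExtensionCounit F) (F.rightKanExtension F) ≫
      F.rightKanExtensionCounit F)

theorem codensityUnit_fac (F : A ⥤ C) [F.HasRightKanExtension F] (a : A) :
    (codensityUnit F).app (F.obj a) ≫ (F.rightKanExtensionCounit F).app a = 𝟙 (F.obj a) := by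
  unfold codensityUnit
  rw [Functor.liftOfIsRightKanExtension_fac_app]
  rfl

theorem codensityMult_fac (F : A ⥤ C) [F.HasRightKanExtension F] (a : A) :
    (codensityMult F).app (F.obj a) ≫ (F.rightKanExtensionCounit F).app a =
      (F.rightKanExtension F).map ((F.rightKanExtensionCounit F).app a) ≫
        (F.rightKanExtensionCounit F).app a := by
  unfold codensityMult
  rw [Functor.liftOfIsRightKanExtension_fac_app]
  simp

/-- The codensity monad of a functor `F` that has a right Kan extension along itself. -/
noncomputable def codensityMonad (F : A ⥤ C) [F.HasRightKanExtension F] : Monad C where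
  toFunctor := F.rightKanExtension F
  η := codensityUnit F
  μ := codensityMult F
  assoc X := by
    let T := F.rightKanExtension F
    let α : T ⋙ T ⋙ T ⟶ T :=
      { app := fun X => T.map ((codensityMult F).app X) ≫ (codensityMult F).app X
        naturality := fun X Y f => by
          have h1 := (codensityMult F).naturality f
          have h2 := congrArg T.map h1
          simp only [Functor.comp_map, Functor.map_comp] at h1 h2 ⊢
          erw [reassoc_of% h2, h1]
          simp [T] }
    let β : T ⋙ T ⋙ T ⟶ T :=
      { app := fun X => (codensityMult F).app (T.obj X) ≫ (codensityMult F).app X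
        naturality := fun X Y f => by
          have h1 := (codensityMult F).naturality f
          have h2 := (codensityMult F).naturality (T.map f)
          simp only [Functor.comp_map] at h1 h2 ⊢
          erw [reassoc_of% h2, h1]
          simp [T] }
    have h : α = β := by
      apply Functor.rightKanExtension_hom_ext
      ext a
      change (T.map ((codensityMult F).app (F.obj a)) ≫ (codensityMult F).app (F.obj a)) ≫
          (F.rightKanExtensionCounit F).app a =
        ((codensityMult F).app (T.obj (F.obj a)) ≫ (codensityMult F).app (F.obj a)) ≫
          (F.rightKanExtensionCounit F).app a
      have h1 := (codensityMult F).naturality ((F.rightKanExtensionCounit F).app a)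
      simp only [Functor.comp_map] at h1
      rw [Category.assoc, Category.assoc, codensityMult_fac, ← reassoc_of% h1,
        codensityMult_fac, ← Functor.map_comp_assoc, ← Functor.map_comp_assoc,
        codensityMult_fac]
    exact congrArg (fun γ : T ⋙ T ⋙ T ⟶ T => γ.app X) h
  left_unit X := by
    let T := F.rightKanExtension F
    let α : T ⟶ T :=
      { app := fun X => (codensityUnit F).app (T.obj X) ≫ (codensityMult F).app X
        naturality := fun X Y f => by
          have h1 := (codensityMult F).naturality f
          have h2 := (codensityUnit F).naturality (T.map f)
          simp only [Functor.comp_map, Functor.id_map] at h1 h2 ⊢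
          erw [reassoc_of% h2, h1]
          simp [T] }
    have h : α = 𝟙 T := by
      apply Functor.rightKanExtension_hom_ext
      ext a
      change ((codensityUnit F).app (T.obj (F.obj a)) ≫ (codensityMult F).app (F.obj a)) ≫
          (F.rightKanExtensionCounit F).app a = 𝟙 _ ≫ (F.rightKanExtensionCounit F).app a
      have h1 := (codensityUnit F).naturality ((F.rightKanExtensionCounit F).app a)
      simp only [Functor.id_map] at h1
      rw [Category.assoc, codensityMult_fac, ← reassoc_of% h1, codensityUnit_fac]
      exact (Category.comp_id _).trans (Category.id_comp _).symm
    exact congrArg (fun γ : T ⟶ T => γ.app X) h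
  right_unit X := by
    let T := F.rightKanExtension F
    let α : T ⟶ T :=
      { app := fun X => T.map ((codensityUnit F).app X) ≫ (codensityMult F).app X
        naturality := fun X Y f => by
          have h1 := (codensityMult F).naturality f
          have h2 := congrArg T.map ((codensityUnit F).naturality f)
          simp only [Functor.comp_map, Functor.id_map, Functor.map_comp] at h1 h2 ⊢
          erw [reassoc_of% h2, h1]
          simp [T] }
    have h : α = 𝟙 T := by
      apply Functor.rightKanExtension_hom_ext
      ext a
      change (T.map ((codensityUnit F).app (F.obj a)) ≫ (codensityMult F).app (F.obj a)) ≫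
          (F.rightKanExtensionCounit F).app a = 𝟙 _ ≫ (F.rightKanExtensionCounit F).app a
      rw [Category.assoc, codensityMult_fac, ← Functor.map_comp_assoc, codensityUnit_fac]
      simp
    exact congrArg (fun γ : T ⟶ T => γ.app X) h

end Codensity

/-! ### The Sierpinski space and the two-element semilattice -/

/-- The two-element set `{0, 1}` (as propositions, `0 = False` and `1 = True`). As a topological
space it is the Sierpinski space, with open sets `∅`, `{1}`, `{0, 1}`; as an ordered set it is the
two-element meet-semilattice with top element `1`. -/
abbrev Two : Type u := ULift.{u} Prop

theorem isOpen_two_iff (s : Set Two.{u}) :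
    IsOpen s ↔ s = ∅ ∨ s = {ULift.up True} ∨ s = Set.univ := by
  have key : ∀ t : Set Prop, IsOpen t ↔ (False ∈ t → True ∈ t) := by
    intro t
    have : IsOpen t ↔ ∀ p ∈ t, t ∈ nhds p := isOpen_iff_mem_nhds
    rw [this]
    constructor
    · intro h hf
      have := h False hf
      simp at this
      simp [this]
    · intro h p hp
      by_cases hh : p
      · simpa [hh] using (by simpa [hh] using hp : True ∈ t)
      · have hf : False ∈ t := by simpa [hh] using hp
        have hu : t = Set.univ := by
          ext q
          by_cases hq : q <;> simp [hq, hf, h hf]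
        simp [hu]
  have hs : IsOpen s ↔ IsOpen (ULift.up ⁻¹' s) :=
    (Homeomorph.ulift (X := Prop)).symm.isOpen_preimage.symm
  rw [hs, key]
  constructor
  · intro h
    by_cases hF : ULift.up False ∈ s
    · right; right
      ext ⟨q⟩
      by_cases hq : q
      · simpa [hq] using h hF
      · simpa [hq] using hF
    · by_cases hT : ULift.up True ∈ s
      · right; left
        ext ⟨q⟩
        by_cases hq : q <;> simp [hq, hF, hT]
      · left
        ext ⟨q⟩
        by_cases hq : q <;> simp [hq, hF, hT]
  · rintro (h | h | h) <;> simp [h]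

/-- A map into the Sierpinski space is continuous iff the preimage of `1` is open. -/
theorem continuous_two_iff {X : Type*} [TopologicalSpace X] {f : X → Two.{u}} :
    Continuous f ↔ IsOpen {x | (f x).down} := by
  rw [← continuous_Prop]
  exact ⟨fun h => continuous_uliftDown.comp h, fun h => continuous_uliftUp.comp h⟩

instance : ContinuousInf Two.{u} where
  continuous_inf := by
    rw [continuous_two_iff]
    have h : {p : Two.{u} × Two.{u} | (p.1 ⊓ p.2).down} =
        {p | p.1.down} ∩ {p | p.2.down} := rfl
    rw [h]
    exact (continuous_two_iff.1 continuous_fst).inter (continuous_two_iff.1 continuous_snd)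

/-! ### The dual adjunction between spaces and meet-semilattices with top -/

noncomputable instance (X : Type*) [TopologicalSpace X] : OrderTop C(X, Two.{u}) where
  top := ContinuousMap.const X ⊤
  le_top f := fun x => le_top (a := f x)

/-- The functor `Top(-, 𝕊) : Top ⥤ MSLᵒᵖ`; meets and top are pointwise. -/
noncomputable def topToMSL : TopCat.{u} ⥤ SemilatInfCat.{u}ᵒᵖ where
  obj X := op (SemilatInfCat.of C(X, Two.{u}))
  map {X Y} f := Quiver.Hom.op (X := SemilatInfCat.of C(Y, Two.{u}))
    (Y := SemilatInfCat.of C(X, Two.{u}))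
    (show InfTopHom C(Y, Two.{u}) C(X, Two.{u}) from
      { toFun := fun g => g.comp f.hom
        map_inf' := fun _ _ => rfl
        map_top' := rfl })

/-- The set `MSL(M, 2)` as a subspace of the power `𝕊 ^ |M|`. -/
noncomputable instance homTwoTopology (M : Type u) [SemilatticeInf M] [OrderTop M] :
    TopologicalSpace (InfTopHom M Two.{u}) :=
  TopologicalSpace.induced (fun χ => (χ : M → Two.{u})) Pi.topologicalSpace

theorem continuous_homTwo_iff {X : Type*} [TopologicalSpace X] {M : Type u} [SemilatticeInf M]
    [OrderTop M] {f : X → InfTopHom M Two.{u}} :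
    Continuous f ↔ ∀ m, Continuous fun x => f x m := by
  rw [continuous_induced_rng, continuous_pi_iff]
  rfl

theorem continuous_eval_homTwo {M : Type u} [SemilatticeInf M] [OrderTop M] (m : M) :
    Continuous fun χ : InfTopHom M Two.{u} => χ m :=
  continuous_homTwo_iff.1 continuous_id m

/-- The functor `MSL(-, 2) : MSLᵒᵖ ⥤ Top`. -/
noncomputable def mslToTop : SemilatInfCat.{u}ᵒᵖ ⥤ TopCat.{u} where
  obj M := TopCat.of (InfTopHom M.unop Two.{u})
  map {M N} h := TopCat.ofHom
    { toFun := fun χ => InfTopHom.comp χ (show InfTopHom N.unop M.unop from h.unop)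
      continuous_toFun := continuous_homTwo_iff.2 fun n =>
        continuous_eval_homTwo ((show InfTopHom N.unop M.unop from h.unop) n) }

/-- The dual adjunction `Top(-, 𝕊) ⊣ MSL(-, 2)`; unit and counit are given by evaluation. -/
noncomputable def topMSLAdjunction : topToMSL.{u} ⊣ mslToTop.{u} :=
  Adjunction.mkOfUnitCounit
    { unit :=
        { app := fun X => TopCat.ofHom
            { toFun := fun x => (show InfTopHom C(X, Two.{u}) Two.{u} from
                { toFun := fun g => g x
                  map_inf' := fun _ _ => rfl
                  map_top' := rfl })
              continuous_toFun := continuous_homTwo_iff.2 fun g => g.continuous }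
          naturality := fun _ _ _ => rfl }
      counit :=
        { app := fun M => Quiver.Hom.op (X := M.unop)
            (Y := SemilatInfCat.of C(InfTopHom M.unop Two.{u}, Two.{u}))
            (show InfTopHom M.unop C(InfTopHom M.unop Two.{u}, Two.{u}) from
              { toFun := fun m => ⟨fun χ => χ m, continuous_eval_homTwo m⟩
                map_inf' := fun a b => ContinuousMap.ext fun χ => map_inf χ a b
                map_top' := ContinuousMap.ext fun χ => map_top χ })
          naturality := fun _ _ _ => rfl }
      left_triangle := rfl
      right_triangle := rfl }

/-- The monad `X ↦ MSL(Top(X, 𝕊), 2)` on `Top` induced by the dual adjunction. -/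
noncomputable def dualFilterMonad : Monad TopCat.{u} := topMSLAdjunction.{u}.toMonad

/-! ### The monad of filters of open sets -/

/-- The filters of open sets of `X` (the filters of the meet-semilattice of open sets). -/
abbrev OpenFilter (X : Type u) [TopologicalSpace X] : Type u := Order.PFilter (Opens X)

/-- The space of filters of open sets, topologised inside the power of `𝕊` indexed by the open
sets. -/
noncomputable instance openFilterTopology (X : Type u) [TopologicalSpace X] :
    TopologicalSpace (OpenFilter X) :=
  TopologicalSpace.induced (fun (F : OpenFilter X) (U : Opens X) => (ULift.up (U ∈ F) : Two.{u}))
    Pi.topologicalSpace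

theorem continuous_openFilter_iff {Y : Type*} [TopologicalSpace Y] {X : Type u}
    [TopologicalSpace X] {f : Y → OpenFilter X} :
    Continuous f ↔ ∀ U : Opens X, IsOpen {y | U ∈ f y} := by
  rw [continuous_induced_rng, continuous_pi_iff]
  exact forall_congr' fun U => continuous_two_iff

/-- The open set `□U` of all filters that contain the open set `U`. -/
def boxOpen {X : Type u} [TopologicalSpace X] (U : Opens X) : Opens (OpenFilter X) :=
  ⟨{F | U ∈ F}, continuous_openFilter_iff.1 continuous_id U⟩

/-- A set of open sets that contains the whole space, is closed under binary intersections and is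
upwards closed, as a filter. -/
def mkOpenFilter {X : Type u} [TopologicalSpace X] (p : Opens X → Prop) (h_top : p ⊤)
    (h_inf : ∀ U V, p U → p V → p (U ⊓ V)) (h_le : ∀ U V, U ≤ V → p U → p V) : OpenFilter X :=
  (Order.IsPFilter.of_def (F := {U | p U}) ⟨⊤, h_top⟩
    (fun U hU V hV => ⟨U ⊓ V, h_inf U V hU hV, inf_le_left, inf_le_right⟩)
    (fun {U V} hUV hU => h_le U V hUV hU)).toPFilter

theorem mem_mkOpenFilter {X : Type u} [TopologicalSpace X] (p : Opens X → Prop) (h_top : p ⊤)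
    (h_inf : ∀ U V, p U → p V → p (U ⊓ V)) (h_le : ∀ U V, U ≤ V → p U → p V) (U : Opens X) :
    U ∈ mkOpenFilter p h_top h_inf h_le ↔ p U := Iff.rfl

theorem openFilter_ext {X : Type u} [TopologicalSpace X] {F G : OpenFilter X}
    (h : ∀ U, U ∈ F ↔ U ∈ G) : F = G := SetLike.ext h

/-- The image filter `{V | f⁻¹ V ∈ F}`. -/
def openFilterMap {X Y : Type u} [TopologicalSpace X] [TopologicalSpace Y] (f : C(X, Y))
    (F : OpenFilter X) : OpenFilter Y :=
  mkOpenFilter (fun V => Opens.comap f V ∈ F) Order.PFilter.top_mem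
    (fun _ _ hU hV => Order.PFilter.inf_mem hU hV)
    (fun _ _ h hU => Order.PFilter.mem_of_le (fun _ hx => h hx) hU)

/-- The filter of open neighbourhoods of a point. -/
def openNhds {X : Type u} [TopologicalSpace X] (x : X) : OpenFilter X :=
  mkOpenFilter (fun U => x ∈ U) trivial (fun _ _ hU hV => ⟨hU, hV⟩) (fun _ _ h hU => h hU)

/-- The filter `{U | □U ∈ 𝔉}`. -/
def openFilterJoin {X : Type u} [TopologicalSpace X] (𝔉 : OpenFilter (OpenFilter X)) :
    OpenFilter X :=
  mkOpenFilter (fun U => boxOpen U ∈ 𝔉)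
    (by
      have h : boxOpen (⊤ : Opens X) = ⊤ := by
        ext F
        exact ⟨fun _ => trivial, fun _ => Order.PFilter.top_mem⟩
      rw [h]
      exact Order.PFilter.top_mem)
    (fun U V hU hV => Order.PFilter.mem_of_le
      (show boxOpen U ⊓ boxOpen V ≤ boxOpen (U ⊓ V) from
        fun _ hF => Order.PFilter.inf_mem hF.1 hF.2) (Order.PFilter.inf_mem hU hV))
    (fun U V h hU => Order.PFilter.mem_of_le
      (show boxOpen U ≤ boxOpen V from fun _ hF => Order.PFilter.mem_of_le h hF) hU)

/-- The endofunctor of `Top` that sends a space to its space of filters of open sets. -/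
noncomputable def openFilterFunctor : TopCat.{u} ⥤ TopCat.{u} where
  obj X := TopCat.of (OpenFilter X)
  map {X Y} f := TopCat.ofHom
    { toFun := openFilterMap f.hom
      continuous_toFun := continuous_openFilter_iff.2 fun V =>
        (boxOpen (Opens.comap f.hom V)).isOpen }

/-- The monad of filters of open sets on `Top`: the unit sends a point to the filter of its open
neighbourhoods, the multiplication sends `𝔉` to `{U | {F | U ∈ F} ∈ 𝔉}`. -/
noncomputable def openFilterMonad : Monad TopCat.{u} where
  toFunctor := openFilterFunctor
  η :=
    { app := fun X => TopCat.ofHom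
        { toFun := openNhds (X := X)
          continuous_toFun := continuous_openFilter_iff.2 fun U => U.isOpen }
      naturality := fun _ _ _ => rfl }
  μ :=
    { app := fun X => TopCat.ofHom
        { toFun := openFilterJoin (X := X)
          continuous_toFun := continuous_openFilter_iff.2 fun U => (boxOpen (boxOpen U)).isOpen }
      naturality := fun _ _ _ => rfl }
  assoc _ := rfl
  left_unit _ := rfl
  right_unit _ := rfl

/-- The characteristic map `X → 𝕊` of an open set. -/
def openChar {X : Type u} [TopologicalSpace X] (U : Opens X) : C(X, Two.{u}) :=
  ⟨fun x => ⟨x ∈ U⟩, continuous_two_iff.2 U.isOpen⟩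

/-- The filter `χ⁻¹(1)` that corresponds to a semilattice morphism `χ : Top(X, 𝕊) → 2`, where open
sets are identified with their characteristic maps. -/
def filterOfHom {X : Type u} [TopologicalSpace X] (χ : InfTopHom C(X, Two.{u}) Two.{u}) :
    OpenFilter X :=
  mkOpenFilter (fun U => (χ (openChar U)).down)
    (by
      have h : openChar (⊤ : Opens X) = ⊤ := rfl
      rw [h, map_top]
      trivial)
    (fun U V hU hV => by
      have h : openChar (U ⊓ V) = openChar U ⊓ openChar V := rfl
      rw [h, map_inf]
      exact ⟨hU, hV⟩)
    (fun U V hUV hU => by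
      have h : openChar U ≤ openChar V := fun x hx => hUV hx
      exact (OrderHomClass.mono χ h : χ (openChar U) ≤ χ (openChar V)) hU)

/-! ### Finite sets and relations -/

open Classical in
/-- The finite power set monad on the category of sets. -/
noncomputable def finPowerset : Monad (Type u) := ofTypeMonad Finset

/-- The full subcategory of the Kleisli category of the finite power set monad given by the finite
sets. -/
abbrev KlFin : Type (u + 1) :=
  ObjectProperty.FullSubcategory fun X : Kleisli finPowerset.{u} => Finite X.of

/-- The functor from finite Kleisli objects to sets that sends `X` to the set of (finite) subsets
of `X` and `f` to `A ↦ ⋃ x ∈ A, f x`. -/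
noncomputable def klFinToSet : KlFin.{u} ⥤ Type u :=
  ObjectProperty.ι _ ⋙ Kleisli.Adjunction.fromKleisli finPowerset

open Classical in
/-- The identification of the set of subsets of a finite set `X` with `𝕊 ^ X`: the bijection
that turns the free meet-semilattice with top on `X` (the subsets of `X`, with `∪` as the meet and
`∅` as the top) into the power of the two-element meet-semilattice. It sends `A` to the map that is
`0` exactly on `A`. -/
noncomputable def subsetsEquivPower (X : KlFin.{u}) :
    klFinToSet.obj X ≃ (X.obj.of → Two.{u}) :=
  haveI : Finite X.obj.of := X.property
  { toFun := fun (A : Finset X.obj.of) x => ⟨x ∉ A⟩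
    invFun := fun φ => ((Set.toFinite {x | ¬ (φ x).down}).toFinset : Finset X.obj.of)
    left_inv := fun (A : Finset X.obj.of) => by
      refine Finset.ext fun x => ?_
      simp
    right_inv := fun φ => by
      funext x
      refine ULift.ext _ _ ?_
      simp }

theorem subsetsEquivPower_union (X : KlFin.{u}) [DecidableEq X.obj.of] (A B : Finset X.obj.of) :
    subsetsEquivPower X (A ∪ B : Finset X.obj.of) =
      subsetsEquivPower X A ⊓ subsetsEquivPower X B := by
  funext x
  refine ULift.ext _ _ (propext ?_)
  change x ∉ A ∪ B ↔ x ∉ A ∧ x ∉ B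
  simp

/-- A morphism of `KlFin` as a map `f : X → P_f Y`. -/
def KlFin.toFun {X Y : KlFin.{u}} (f : X ⟶ Y) (x : X.obj.of) : Finset Y.obj.of := f.hom.of x

theorem mem_klFinToSet_map {X Y : KlFin.{u}} (f : X ⟶ Y) (A : Finset X.obj.of) (y : Y.obj.of) :
    y ∈ (show Finset Y.obj.of from klFinToSet.map f A) ↔ ∃ x ∈ A, y ∈ KlFin.toFun f x := by
  classical
  have h : (show Finset Y.obj.of from klFinToSet.map f A) =
      Finset.sup (Finset.image (KlFin.toFun f) A) id := by
    change joinM (KlFin.toFun f <$> A) = _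
    simp only [joinM, Finset.bind_def, Finset.fmap_def]
    congr!
  rw [h]
  simp [Finset.mem_sup]

theorem subsetsEquivPower_map {X Y : KlFin.{u}} (f : X ⟶ Y) (φ : X.obj.of → Two.{u})
    (y : Y.obj.of) :
    (subsetsEquivPower Y (klFinToSet.map f ((subsetsEquivPower X).symm φ)) y).down ↔
      ∀ x, y ∈ KlFin.toFun f x → (φ x).down := by
  have h := mem_klFinToSet_map f ((subsetsEquivPower X).symm φ) y
  change ¬ (y ∈ (show Finset Y.obj.of from _)) ↔ _
  rw [h]
  have h2 : ∀ x, x ∈ (show Finset X.obj.of from (subsetsEquivPower X).symm φ) ↔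
      ¬ (φ x).down := by
    intro x
    exact Set.Finite.mem_toFinset _
  constructor
  · intro hn x hx
    by_contra hc
    exact hn ⟨x, (h2 x).2 hc, hx⟩
  · rintro hn ⟨x, hx, hy⟩
    exact (h2 x).1 hx (hn x hy)

/-- The functor from finite Kleisli objects to topological spaces that sends `X` to `𝕊 ^ X`: it is
`klFinToSet`, transported along the identification of subsets of `X` with points of `𝕊 ^ X`. -/
noncomputable def klFinToTop : KlFin.{u} ⥤ TopCat.{u} where
  obj X := TopCat.of (X.obj.of → Two.{u})
  map {X Y} f := TopCat.ofHom
    { toFun := fun φ => subsetsEquivPower Y (klFinToSet.map f ((subsetsEquivPower X).symm φ))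
      continuous_toFun := by
        have : Finite X.obj.of := X.property
        refine continuous_pi fun y => continuous_two_iff.2 ?_
        simp only [subsetsEquivPower_map, Set.ofPred_forall]
        exact isOpen_iInter_of_finite fun x => isOpen_iInter_of_finite fun _ =>
          continuous_two_iff.1 (continuous_apply x) }
  map_id X := by
    ext φ
    simp
  map_comp f g := by
    ext φ
    simp

/-! ### Recognising codensity monads -/

/-! An open set is the same as a continuous map to `𝕊`, intersections being pointwise meets, and a
map to `2` that preserves finite meets is determined by the preimage of `1`, which is a filter.
Under this translation both monad structures are the same formulas, which gives the first claim.

For the second, the pointwise Kan extension at `X` is a limit over the comma category of maps `X ⟶ 𝕊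
^ A` with `A` finite, that is, over finite families of maps `X → 𝕊`. A Kleisli morphism acts by
taking meets of coordinates over finite index sets. Projections to one coordinate show that a cone
is determined by its legs at single maps (`coneEval_powerComponent`); the remaining compatibility
says that these legs preserve finite meets (`coneEval_down_iff`). A cone with apex `W` is therefore
a continuous map `W → MSL(Top(X, 𝕊), 2)`, so this space is the limit (`dualFilterIsPointwise`).

Finally, uniqueness of Kan extensions gives an isomorphism with the codensity functor, and it
respects the monad structures because evaluation at projections is compatible with unit and
multiplication (`monadIsoCodensityMonad`). -/

section CodensityIso

variable {A : Type u₁} [Category.{v₁} A] {C : Type u₂} [Category.{v₂} C]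

/-- A monad whose underlying functor is a right Kan extension of `F` along itself, with a counit
that is compatible with the unit and the multiplication, is the codensity monad of `F`. -/
noncomputable def monadIsoCodensityMonad (F : A ⥤ C) [F.HasRightKanExtension F] (T : Monad C)
    (φ : F ⋙ T.toFunctor ⟶ F) [T.toFunctor.IsRightKanExtension φ]
    (hη : ∀ a, T.η.app (F.obj a) ≫ φ.app a = 𝟙 (F.obj a))
    (hμ : ∀ a, T.μ.app (F.obj a) ≫ φ.app a = T.map (φ.app a) ≫ φ.app a) :
    T ≅ codensityMonad F := by
  let R := F.rightKanExtension F
  let c : F ⋙ R ⟶ F := F.rightKanExtensionCounit F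
  let i : T.toFunctor ≅ R := Functor.rightKanExtensionUnique T.toFunctor φ R c
  -- This equation characterises `i`. Transformations into `R` agree once they agree after
  -- restriction along `F` and composition with `c`, so both monad laws reduce to it.
  have hi : ∀ a, i.hom.app (F.obj a) ≫ c.app a = φ.app a := fun a => by
    simp only [i, Functor.rightKanExtensionUnique_hom]
    exact Functor.liftOfIsRightKanExtension_fac_app R c T.toFunctor φ a
  have hunit : T.η ≫ i.hom = codensityUnit F := by
    apply Functor.hom_ext_of_isRightKanExtension R c
    ext a
    change (T.η.app (F.obj a) ≫ i.hom.app (F.obj a)) ≫ c.app a =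
      (codensityUnit F).app (F.obj a) ≫ c.app a
    rw [Category.assoc, hi, hη, codensityUnit_fac]
  have hmult : T.μ ≫ i.hom = (i.hom ◫ i.hom) ≫ codensityMult F := by
    apply Functor.hom_ext_of_isRightKanExtension R c
    ext a
    change (T.μ.app (F.obj a) ≫ i.hom.app (F.obj a)) ≫ c.app a =
      ((i.hom.app (T.obj (F.obj a)) ≫ R.map (i.hom.app (F.obj a))) ≫
        (codensityMult F).app (F.obj a)) ≫ c.app a
    rw [Category.assoc, hi, hμ, Category.assoc, codensityMult_fac, Category.assoc,
      ← Functor.map_comp_assoc, hi, ← NatTrans.naturality_assoc, hi]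
  refine MonadIso.mk (N := codensityMonad F) i (fun X => NatTrans.congr_app hunit X) fun X => ?_
  refine (NatTrans.congr_app hmult X).trans ?_
  -- The two ways of writing the horizontal composite of `i.hom` with itself differ by naturality of
  -- `i.hom`.
  change (i.hom.app (T.obj X) ≫ R.map (i.hom.app X)) ≫ (codensityMult F).app X =
    (T.map (i.hom.app X) ≫ i.hom.app (R.obj X)) ≫ (codensityMult F).app X
  rw [i.hom.naturality]

end CodensityIso

/-! ### The dual filter monad and the monad of filters of open sets -/

section Filters

/-- The open set on which a map into the Sierpinski space takes the value `1`. -/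
def openOfMap {X : Type u} [TopologicalSpace X] (g : C(X, Two.{u})) : Opens X :=
  ⟨{x | (g x).down}, continuous_two_iff.1 g.continuous⟩

/-- The semilattice morphism `Top(X, 𝕊) → 2` that corresponds to a filter of open sets. -/
def homOfFilter {X : Type u} [TopologicalSpace X] (F : OpenFilter X) :
    InfTopHom C(X, Two.{u}) Two.{u} where
  toFun g := ⟨openOfMap g ∈ F⟩
  map_inf' g h := by
    refine ULift.ext _ _ (propext ?_)
    change openOfMap g ⊓ openOfMap h ∈ F ↔ openOfMap g ∈ F ∧ openOfMap h ∈ F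
    exact ⟨fun H => ⟨Order.PFilter.mem_of_le inf_le_left H, Order.PFilter.mem_of_le inf_le_right H⟩,
      fun H => Order.PFilter.inf_mem H.1 H.2⟩
  map_top' := by
    refine ULift.ext _ _ (propext ?_)
    exact ⟨fun _ => trivial, fun _ => Order.PFilter.top_mem⟩

/-- Semilattice morphisms `Top(X, 𝕊) → 2` are the same as filters of open sets, topologically. -/
def homFilterHomeomorph (X : Type u) [TopologicalSpace X] :
    InfTopHom C(X, Two.{u}) Two.{u} ≃ₜ OpenFilter X where
  toFun := filterOfHom
  invFun := homOfFilter
  left_inv _ := rfl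
  right_inv _ := rfl
  continuous_toFun := continuous_openFilter_iff.2 fun U =>
    continuous_two_iff.1 (continuous_eval_homTwo (openChar U))
  continuous_invFun := continuous_homTwo_iff.2 fun g =>
    continuous_two_iff.2 (boxOpen (openOfMap g)).isOpen

/-- The dual filter monad is the monad of filters of open sets. -/
noncomputable def dualFilterMonadIso : dualFilterMonad.{u} ≅ openFilterMonad.{u} :=
  MonadIso.mk (M := dualFilterMonad.{u}) (N := openFilterMonad.{u})
    (NatIso.ofComponents (F := dualFilterMonad.{u}.toFunctor) (G := openFilterMonad.{u}.toFunctor)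
      (fun X => TopCat.isoOfHomeo (homFilterHomeomorph X)) (fun _ => rfl))
    (fun _ => rfl) (fun _ => rfl)

end Filters

/-! ### The dual filter monad as a pointwise right Kan extension -/

section Kan

theorem klFinToTop_map_apply {X Y : KlFin.{u}} (f : X ⟶ Y) (φ : X.obj.of → Two.{u})
    (y : Y.obj.of) :
    ((klFinToTop.map f φ : Y.obj.of → Two.{u}) y).down ↔
      ∀ x, y ∈ KlFin.toFun f x → (φ x).down :=
  subsetsEquivPower_map f φ y

/-- A semilattice morphism preserves finite meets of maps into the Sierpinski space. -/
theorem infTopHom_apply_down_iff {X : Type u} [TopologicalSpace X]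
    (χ : InfTopHom C(X, Two.{u}) Two.{u}) {I : Type*} (S : Finset I) (g : I → C(X, Two.{u})) :
    ∀ h : C(X, Two.{u}), (∀ x, (h x).down ↔ ∀ i ∈ S, (g i x).down) →
      ((χ h).down ↔ ∀ i ∈ S, (χ (g i)).down) := by
  classical
  induction S using Finset.induction_on with
  | empty =>
    intro h hh
    have : h = ⊤ := ContinuousMap.ext fun x => ULift.ext _ _ (propext
      ⟨fun _ => trivial, fun _ => (hh x).2 (by simp)⟩)
    rw [this, map_top]
    exact ⟨fun _ i hi => absurd hi (Finset.notMem_empty i), fun _ => trivial⟩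
  | insert a S _ ih =>
    intro h hh
    -- The meet over the remaining indices must itself be a continuous map before `χ` can be applied
    -- to it; finiteness of `S` makes it so.
    have hk : Continuous fun x => (⟨∀ i ∈ S, (g i x).down⟩ : Two.{u}) := by
      refine continuous_two_iff.2 ?_
      simp only [Set.ofPred_forall]
      exact isOpen_biInter_finset fun i _ => continuous_two_iff.1 (g i).continuous
    let k : C(X, Two.{u}) := ⟨_, hk⟩
    have : h = g a ⊓ k := ContinuousMap.ext fun x => ULift.ext _ _ (propext <| by
      rw [hh x, Finset.forall_mem_insert]
      rfl)
    rw [this, map_inf, Finset.forall_mem_insert, ← ih k fun x => Iff.rfl]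
    rfl

/-- A component of a continuous map into a power of the Sierpinski space. -/
noncomputable def powerComponent {X : TopCat.{u}} {A : KlFin.{u}} (g : X ⟶ klFinToTop.obj A) (a : A.obj.of) :
    C(X, Two.{u}) :=
  ⟨fun x => (g x : A.obj.of → Two.{u}) a, (continuous_apply a).comp g.hom.continuous⟩

/-- The counit `MSL(Top(𝕊 ^ A, 𝕊), 2) ⟶ 𝕊 ^ A`: evaluation at the projections. -/
noncomputable def dualFilterCounit :
    klFinToTop.{u} ⋙ dualFilterMonad.{u}.toFunctor ⟶ klFinToTop.{u} where
  app A := TopCat.ofHom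
    (X := InfTopHom C(A.obj.of → Two.{u}, Two.{u}) Two.{u}) (Y := A.obj.of → Two.{u})
    { toFun := fun χ a => χ ⟨fun φ => φ a, continuous_apply a⟩
      continuous_toFun := continuous_pi fun _ => continuous_eval_homTwo _ }
  naturality A B f := by
    classical
    have : Finite A.obj.of := A.property
    have := Fintype.ofFinite A.obj.of
    ext (χ : InfTopHom C(A.obj.of → Two.{u}, Two.{u}) Two.{u})
    refine funext fun b => ULift.ext _ _ (propext ?_)
    refine Iff.trans ?_ (klFinToTop_map_apply f _ b).symm
    -- Coordinate `b` of the map induced by `f` is the meet of the projections at those `a` with `b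
    -- ∈ f a`, a finite meet, which `χ` preserves.
    refine (infTopHom_apply_down_iff χ (Finset.univ.filter fun a => b ∈ KlFin.toFun f a)
      (fun a => ⟨fun φ => φ a, continuous_apply a⟩) _ fun φ => ?_).trans ?_
    · refine (klFinToTop_map_apply f φ b).trans ?_
      simp
    · simp only [Finset.mem_filter, Finset.mem_univ, true_and]
      rfl

/-! ### Cones over the comma category -/

/-- A finite set as an object of `KlFin`. -/
noncomputable def KlFin.of (I : Type u) [hI : Finite I] : KlFin.{u} := ⟨Kleisli.mk _ I, hI⟩

/-- A map `I → P_f J` as a morphism of `KlFin`. -/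
noncomputable def KlFin.ofFun {I J : Type u} [Finite I] [Finite J] (R : I → Finset J) :
    KlFin.of I ⟶ KlFin.of J :=
  ObjectProperty.homMk (Kleisli.Hom.mk (TypeCat.ofHom R))

/-- A finite family of maps `X → 𝕊`, as an object of the comma category. -/
noncomputable def familyArrow {X : TopCat.{u}} {I : Type u} [Finite I] (g : I → C(X, Two.{u})) :
    StructuredArrow X klFinToTop.{u} :=
  StructuredArrow.mk (Y := KlFin.of I) (TopCat.ofHom (Y := I → Two.{u})
    ⟨fun x i => g i x, continuous_pi fun i => (g i).continuous⟩)

/-- A map `f : A → P_f B` relates the legs of a cone. -/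
theorem cone_leg_iff {X : TopCat.{u}}
    (s : Limits.Cone (StructuredArrow.proj X klFinToTop.{u} ⋙ klFinToTop.{u}))
    {a b : StructuredArrow X klFinToTop.{u}} (f : a.right ⟶ b.right)
    (hf : ∀ (x : X) (j : b.right.obj.of), (powerComponent b.hom j x).down ↔
      ∀ i, j ∈ KlFin.toFun f i → (powerComponent a.hom i x).down)
    (w : s.pt) (j : b.right.obj.of) :
    (powerComponent (s.π.app b) j w).down ↔
      ∀ i, j ∈ KlFin.toFun f i → (powerComponent (s.π.app a) i w).down := by
  -- The hypothesis `hf` is the commuting triangle over `X`, so `f` is a morphism of the comma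
  -- category and the cone is compatible with it.
  let m : a ⟶ b := StructuredArrow.homMk f (by
    ext x
    exact funext fun j => ULift.ext _ _ (propext
      ((klFinToTop_map_apply f _ j).trans (hf x j).symm)))
  have h : s.π.app b = s.π.app a ≫ klFinToTop.map f := (s.w m).symm
  rw [h]
  exact klFinToTop_map_apply f _ j

/-- The leg at a single map `X → 𝕊` of a cone over the comma category. -/
noncomputable def coneEval {X : TopCat.{u}}
    (s : Limits.Cone (StructuredArrow.proj X klFinToTop.{u} ⋙ klFinToTop.{u}))
    (g : C(X, Two.{u})) : C(s.pt, Two.{u}) :=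
  powerComponent (s.π.app (familyArrow fun _ : PUnit => g)) PUnit.unit

-- The projection `𝕊 ^ A → 𝕊` to coordinate `i` comes from the Kleisli morphism with `i ↦ {*}` and
-- every other index sent to `∅`: the meet then runs over `i` alone. Hence the legs at single maps
-- determine the whole cone.
open Classical in
theorem coneEval_powerComponent {X : TopCat.{u}}
    (s : Limits.Cone (StructuredArrow.proj X klFinToTop.{u} ⋙ klFinToTop.{u}))
    (a : StructuredArrow X klFinToTop.{u}) (i : a.right.obj.of) :
    coneEval s (powerComponent a.hom i) = powerComponent (s.π.app a) i := by
  have : Finite a.right.obj.of := a.right.property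
  refine ContinuousMap.ext fun w => ULift.ext _ _ (propext ?_)
  have key : ∀ (p : a.right.obj.of → Prop) (j : PUnit),
      (∀ k, j ∈ (if k = i then {PUnit.unit} else ∅ : Finset PUnit) → p k) ↔ p i := by
    intro p j
    constructor
    · intro h
      exact h i (by simp)
    · intro h k hk
      by_cases hki : k = i
      · exact hki ▸ h
      · simp [hki] at hk
  refine (cone_leg_iff s (a := a)
    (b := familyArrow fun _ : PUnit => powerComponent a.hom i)
    (KlFin.ofFun (I := a.right.obj.of) fun k => if k = i then {PUnit.unit} else ∅)
    (fun x j => ?_) w PUnit.unit).trans ?_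
  · exact (key (fun k => (powerComponent a.hom k x).down) j).symm
  · exact key (fun k => (powerComponent (s.π.app a) k w).down) PUnit.unit

/-- The leg at a finite meet is the meet of the legs. -/
theorem coneEval_down_iff {X : TopCat.{u}}
    (s : Limits.Cone (StructuredArrow.proj X klFinToTop.{u} ⋙ klFinToTop.{u}))
    {I : Type u} [Finite I] (g : I → C(X, Two.{u})) (h : C(X, Two.{u}))
    (hh : ∀ x, (h x).down ↔ ∀ i, (g i x).down) (w : s.pt) :
    (coneEval s h w).down ↔ ∀ i, (coneEval s (g i) w).down := by
  have hg : ∀ i, coneEval s (g i) = powerComponent (s.π.app (familyArrow g)) i := fun i =>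
    coneEval_powerComponent s (familyArrow g) i
  simp only [hg]
  -- The Kleisli morphism sending every index to `{*}` induces the full meet `𝕊 ^ I → 𝕊`.
  refine (cone_leg_iff s (a := familyArrow g) (b := familyArrow fun _ : PUnit => h)
    (KlFin.ofFun (I := I) fun _ => {PUnit.unit}) (fun x j => ?_) w PUnit.unit).trans ?_
  · exact (hh x).trans (forall_congr' fun i =>
      ⟨fun H _ => H, fun H => H (Finset.mem_singleton.2 rfl)⟩)
  · exact forall_congr' fun i => ⟨fun H => H (Finset.mem_singleton.2 rfl), fun H _ => H⟩

/-- The map into `MSL(Top(X, 𝕊), 2)` induced by a cone. -/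
noncomputable def coneLift {X : TopCat.{u}}
    (s : Limits.Cone (StructuredArrow.proj X klFinToTop.{u} ⋙ klFinToTop.{u})) :
    C(s.pt, InfTopHom C(X, Two.{u}) Two.{u}) where
  toFun w :=
    { toFun := fun g => coneEval s g w
      map_inf' := fun g h => ULift.ext _ _ (propext <| by
        -- A two-element family gives binary meets. `Bool.forall_bool` lists `false`, hence `h`,
        -- first, which is why the conjunctions are swapped.
        refine (coneEval_down_iff s (fun i : ULift Bool => cond i.down g h) (g ⊓ h)
          (fun x => ?_) w).trans ?_
        · rw [ULift.forall, Bool.forall_bool]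
          exact and_comm
        · rw [ULift.forall, Bool.forall_bool]
          exact and_comm)
      map_top' := ULift.ext _ _ (propext
        -- The top element is the meet of the empty family.
        ⟨fun _ => trivial, fun _ => (coneEval_down_iff s (fun i : PEmpty => i.elim) ⊤
          (fun _ => ⟨fun _ i => i.elim, fun _ => trivial⟩) w).2 fun i => i.elim⟩) }
  continuous_toFun := continuous_homTwo_iff.2 fun g => (coneEval s g).continuous

/-- The dual filter monad is a pointwise right Kan extension of `klFinToTop` along itself. -/
noncomputable def dualFilterIsPointwise :
    (Functor.RightExtension.mk dualFilterMonad.{u}.toFunctor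
      dualFilterCounit.{u}).IsPointwiseRightKanExtension := fun X =>
  { lift := fun s => TopCat.ofHom (coneLift s)
    fac := fun s a => by
      ext w
      exact funext fun i => congrArg (fun k : C(s.pt, Two.{u}) => k w)
        (coneEval_powerComponent s a i)
    uniq := fun s m hm => by
      ext w
      refine DFunLike.ext (F := InfTopHom C(X, Two.{u}) Two.{u}) _ _ fun g => ?_
      -- The value of `m w` at `g` is the component of the limit cone at the one-member family `g`,
      -- so it is forced by the leg of `s` there.
      have h := hm (familyArrow fun _ : PUnit => g)
      change _ = powerComponent (s.π.app (familyArrow fun _ : PUnit => g)) PUnit.unit w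
      rw [← h]
      rfl }

end Kan

/-! ### The two isomorphisms of monads -/

theorem mainTheorem4 :
    (∃ e : dualFilterMonad.{u} ≅ openFilterMonad.{u},
      ∀ (X : TopCat.{u}) (χ : InfTopHom C(X, Two.{u}) Two.{u}),
        e.hom.app X χ = filterOfHom χ) ∧
    ∃ _ : klFinToTop.{u}.HasPointwiseRightKanExtension klFinToTop.{u},
      Nonempty (dualFilterMonad.{u} ≅ codensityMonad klFinToTop.{u}) := by
  refine ⟨⟨dualFilterMonadIso, fun _ _ => rfl⟩,
    dualFilterIsPointwise.hasPointwiseRightKanExtension, ?_⟩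
  have := dualFilterIsPointwise.{u}.hasPointwiseRightKanExtension
  have : dualFilterMonad.{u}.toFunctor.IsRightKanExtension dualFilterCounit.{u} :=
    dualFilterIsPointwise.{u}.isRightKanExtension
  -- Both conditions hold by unfolding: evaluating a point at the projections returns its
  -- coordinates, and a projection composed with the counit is evaluation at that projection, which
  -- is what the multiplication uses.
  exact ⟨monadIsoCodensityMonad klFinToTop dualFilterMonad dualFilterCounit
    (fun _ => rfl) (fun _ => rfl)⟩
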